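/- Let $n\ge 0$ be an integer and let $a,b>0$ be real numbers. Let $f:\mathbb{R}^n\times[0,\infty)\to(0,\infty)$ be a positive classical solution of the Newell–Whitehead equation $$f_t=\Delta f+af-bf^3,$$ that is, $f$ is continuous on $\mathbb{R}^n\times[0,\infty)$, and at every time $t>0$ it is $C^2$ in $x$, differentiable in $t$, and satisfies the equation ($\Delta$ is the Laplacian in $x\in\mathbb{R}^n$). If $f$ is a standing solution, i.e. $f_t=0$ on $\mathbb{R}^n\times(0,\infty)$, then $f$ is constant on $\mathbb{R}^n\times[0,\infty)$. -/

import Mathlib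

/-- `f : ℝⁿ × [0, ∞) → ℝ` (written `f x t`, with only the values for `t ≥ 0` relevant) is a
classical solution of the Newell–Whitehead equation `f_t = Δ f + a f - b f³`: it is continuous on
`ℝⁿ × [0, ∞)`, and for every `t > 0` it is `C²` in `x`, differentiable in `t`, and satisfies the
equation, where `Δ` is the Laplacian in the space variable `x ∈ ℝⁿ`. -/
structure IsNewellWhiteheadSolution {n : ℕ} (a b : ℝ)
    (f : EuclideanSpace ℝ (Fin n) → ℝ → ℝ) : Prop where
  continuousOn : ContinuousOn (fun p : EuclideanSpace ℝ (Fin n) × ℝ => f p.1 p.2)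
    (Set.univ ×ˢ Set.Ici 0)
  contDiff_space : ∀ t : ℝ, 0 < t → ContDiff ℝ 2 (fun x => f x t)
  differentiableAt_time : ∀ x, ∀ t : ℝ, 0 < t → DifferentiableAt ℝ (fun s => f x s) t
  equation : ∀ x, ∀ t : ℝ, 0 < t →
    deriv (fun s => f x s) t
      = Laplacian.laplacian (fun y => f y t) x + a * f x t - b * f x t ^ 3

/-- A function of space and time is standing if `f_t = 0` (used for solutions, which are
differentiable in time at every `t > 0`). -/
def IsStanding {n : ℕ} (f : EuclideanSpace ℝ (Fin n) → ℝ → ℝ) : Prop :=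
  ∀ x, ∀ t : ℝ, 0 < t → deriv (fun s => f x s) t = 0

/-! Each slice `u = f(·, t)`, `t > 0`, is a positive entire solution of `Δu = b u³ - a u`. With `s =
√(a / b)` and `q = R² - |x - c|²`, two barriers on the ball about `c` pin `u c`. At a maximum of `(u
- s) q` the cubic term dominates, so `u c - s = O(1 / R)` when `u c ≥ s`
(`sub_sq_mul_sq_le_of_laplacian_eq`). Touching `u` from below by `m q²` gives `a - b (u c)² ≤ O(1 /
R²)` (`le_mul_sq_of_laplacian_eq`). Letting `R → ∞` forces `u = s`, with no growth assumption on
`u`; continuity extends this to `t = 0`. -/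

/-- Necessary second-order condition at a local maximum of a function of one real variable. -/
theorem IsLocalMax.second_deriv_nonpos {g g' : ℝ → ℝ} {c x : ℝ} (hmax : IsLocalMax g x)
    (hg : ∀ t, HasDerivAt g (g' t) t) (hg' : HasDerivAt g' c x) : c ≤ 0 := by
  by_contra! hc
  have hd : deriv g = g' := funext fun t => (hg t).deriv
  have h0 : g' x = 0 := hmax.hasDerivAt_eq_zero (hg x)
  -- If `c > 0`, then `x` is also a local minimum, so `g` is locally constant and `c = 0`.
  have hmin : IsLocalMin g x :=
    isLocalMin_of_deriv_deriv_pos (by rw [hd, hg'.deriv]; exact hc) (by rw [hd, h0])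
      (hg x).continuousAt
  have hconst : g =ᶠ[nhds x] fun _ => g x := by
    filter_upwards [hmin, hmax] with t h₁ h₂ using le_antisymm h₂ h₁
  have hz : g' =ᶠ[nhds x] fun _ => 0 := by
    filter_upwards [hconst.eventuallyEq_nhds] with t ht
    rw [← hd, ht.deriv_eq, deriv_const]
  have := hz.deriv_eq
  rw [hg'.deriv, deriv_const] at this
  exact hc.ne' this

section BallBump

variable {E : Type*} [NormedAddCommGroup E]

/-- The function `R² - |x - c|²`, positive on the ball of radius `R` about `c`. -/
def ballBump (R : ℝ) (c x : E) : ℝ := R ^ 2 - ‖x - c‖ ^ 2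

theorem ballBump_self (R : ℝ) (c : E) : ballBump R c c = R ^ 2 := by simp [ballBump]

theorem ballBump_le (R : ℝ) (c x : E) : ballBump R c x ≤ R ^ 2 := by
  have := sq_nonneg ‖x - c‖
  simp only [ballBump]; linarith

theorem continuous_ballBump (R : ℝ) (c : E) : Continuous (ballBump R c) := by
  unfold ballBump; fun_prop

theorem ballBump_nonneg {R : ℝ} {c x : E} (hx : x ∈ Metric.closedBall c R) :
    0 ≤ ballBump R c x := by
  rw [mem_closedBall_iff_norm] at hx
  have := norm_nonneg (x - c)
  simp only [ballBump]; nlinarith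

theorem mem_ball_of_ballBump_pos {R : ℝ} (hR : 0 < R) {c x : E} (hx : 0 < ballBump R c x) :
    x ∈ Metric.ball c R := by
  rw [mem_ball_iff_norm]
  simp only [ballBump] at hx
  exact lt_of_pow_lt_pow_left₀ 2 hR.le (by linarith)

end BallBump

/-! ### Second-order conditions along lines, summed to the Laplacian -/

section Laplacian

variable {E : Type*} [NormedAddCommGroup E] [InnerProductSpace ℝ E]

theorem hasDerivAt_comp_line {u : E → ℝ} (hu : Differentiable ℝ u) (x e : E) (t : ℝ) :
    HasDerivAt (fun s : ℝ => u (x + s • e)) (fderiv ℝ u (x + t • e) e) t := by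
  have hl : HasDerivAt (fun s : ℝ => x + s • e) e t := by
    simpa using ((hasDerivAt_id t).smul_const e).const_add x
  exact (hu _).hasFDerivAt.comp_hasDerivAt t hl

theorem hasDerivAt_fderiv_comp_line {u : E → ℝ} (hu : ContDiff ℝ 2 u) (x e : E) :
    HasDerivAt (fun s : ℝ => fderiv ℝ u (x + s • e) e) (iteratedFDeriv ℝ 2 u x ![e, e]) 0 := by
  have hl : HasDerivAt (fun s : ℝ => x + s • e) e 0 := by
    simpa using ((hasDerivAt_id (0 : ℝ)).smul_const e).const_add x
  have hd : Differentiable ℝ (fderiv ℝ u) :=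
    (hu.fderiv_right (m := 1) (by norm_num)).differentiable (by norm_num)
  have h := (hd (x + (0 : ℝ) • e)).hasFDerivAt.comp_hasDerivAt (0 : ℝ) hl
  have h' := h.clm_apply (hasDerivAt_const (0 : ℝ) e)
  simpa [iteratedFDeriv_two_apply] using h'

theorem ballBump_line (R : ℝ) (c x : E) {e : E} (he : ‖e‖ = 1) (t : ℝ) :
    ballBump R c (x + t • e) = ballBump R c x - 2 * inner ℝ (x - c) e * t - t ^ 2 := by
  have : x + t • e - c = (x - c) + t • e := by abel
  simp only [ballBump, this]
  rw [norm_add_sq_real, inner_smul_right, norm_smul, he, mul_one, Real.norm_eq_abs, sq_abs]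
  ring

theorem hasDerivAt_ballBump_line (R : ℝ) (c x : E) {e : E} (he : ‖e‖ = 1) (t : ℝ) :
    HasDerivAt (fun s : ℝ => ballBump R c (x + s • e))
      (-(2 * inner ℝ (x - c) e) - 2 * t) t := by
  simp only [ballBump_line R c x he]
  have h := (((hasDerivAt_id t).const_mul (2 * inner ℝ (x - c) e)).const_sub
    (ballBump R c x)).sub ((hasDerivAt_id t).pow 2)
  refine HasDerivAt.congr_deriv (h.congr_of_eventuallyEq ?_) ?_
  · exact Filter.Eventually.of_forall fun s => by simp
  · simp

theorem continuous_line (x e : E) : Continuous fun t : ℝ => x + t • e := by fun_prop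

theorem hasDerivAt_ballBump_line_deriv (d : ℝ) :
    HasDerivAt (fun t : ℝ => -(2 * d) - 2 * t) (-2) 0 := by
  simpa using ((hasDerivAt_id (0 : ℝ)).const_mul 2).const_sub (-(2 * d))

theorem iteratedFDeriv_le_of_isLocalMax_mul_ballBump {u : E → ℝ} (hu : ContDiff ℝ 2 u)
    {R s : ℝ} {c x e : E} (he : ‖e‖ = 1) (hq : 0 < ballBump R c x)
    (hmax : IsLocalMax (fun y => (u y - s) * ballBump R c y) x) :
    ballBump R c x ^ 2 * iteratedFDeriv ℝ 2 u x ![e, e]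
      ≤ (u x - s) * (8 * inner ℝ (x - c) e ^ 2 + 2 * ballBump R c x) := by
  have hU := fun t => (hasDerivAt_comp_line (hu.differentiable (by norm_num)) x e t).sub_const s
  have hU' := hasDerivAt_fderiv_comp_line hu x e
  have hQ := hasDerivAt_ballBump_line R c x he
  have hQ' := hasDerivAt_ballBump_line_deriv (inner ℝ (x - c) e)
  have hm : IsLocalMax (fun t : ℝ => (u (x + t • e) - s) * ballBump R c (x + t • e)) 0 := by
    have := (continuous_line x e).tendsto 0
    simp only [zero_smul, add_zero] at this
    simpa [IsLocalMax, IsMaxFilter] using this.eventually hmax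
  have h1 := fun t => (hU t).mul (hQ t)
  have h2 := (hU'.mul (hQ 0)).add ((hU 0).mul hQ')
  have h0 := hm.hasDerivAt_eq_zero (h1 0)
  have h3 := hm.second_deriv_nonpos h1 h2
  simp only [zero_smul, add_zero, mul_zero, sub_zero] at h0 h3
  generalize ballBump R c x = q at *
  generalize iteratedFDeriv ℝ 2 u x ![e, e] = w at *
  generalize fderiv ℝ u x e = p at *
  generalize inner ℝ (x - c) e = d at *
  -- The first-order condition `p q = 2 d (u - s)` eliminates the gradient term `p`.
  linear_combination q * h3 + 4 * d * h0

/-- The square matters: `(q²)'' = 8 d² - 4 q` gains the term `8 d²`, which after summation is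
positive near the sphere, where `q` is small. -/
theorem le_iteratedFDeriv_of_isLocalMin_sub_ballBump_sq {u : E → ℝ} (hu : ContDiff ℝ 2 u)
    {R m : ℝ} {c x e : E} (he : ‖e‖ = 1)
    (hmin : IsLocalMin (fun y => u y - m * ballBump R c y ^ 2) x) :
    m * (8 * inner ℝ (x - c) e ^ 2 - 4 * ballBump R c x) ≤ iteratedFDeriv ℝ 2 u x ![e, e] := by
  have hU := hasDerivAt_comp_line (hu.differentiable (by norm_num)) x e
  have hU' := hasDerivAt_fderiv_comp_line hu x e
  have hQ := hasDerivAt_ballBump_line R c x he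
  have hQ' := hasDerivAt_ballBump_line_deriv (inner ℝ (x - c) e)
  have hm : IsLocalMax (fun t : ℝ => m * (ballBump R c (x + t • e) * ballBump R c (x + t • e))
      - u (x + t • e)) 0 := by
    have := (continuous_line x e).tendsto 0
    simp only [zero_smul, add_zero] at this
    have h := this.eventually hmin
    simp only [IsLocalMax, IsMaxFilter, zero_smul, add_zero]
    filter_upwards [h] with t ht
    linarith
  have h1 := fun t => (((hQ t).mul (hQ t)).const_mul m).sub (hU t)
  have h2 := (((hQ'.mul (hQ 0)).add ((hQ 0).mul hQ')).const_mul m).sub hU'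
  have h3 := hm.second_deriv_nonpos h1 h2
  simp only [zero_smul, add_zero, mul_zero, sub_zero] at h3
  linarith

variable [FiniteDimensional ℝ E]

/-- Maximum principle for `(u - s) (R² - |x - c|²)`. -/
theorem laplacian_le_of_isLocalMax_mul_ballBump {u : E → ℝ} (hu : ContDiff ℝ 2 u)
    {R s : ℝ} {c x : E} (hq : 0 < ballBump R c x)
    (hmax : IsLocalMax (fun y => (u y - s) * ballBump R c y) x) :
    ballBump R c x ^ 2 * Laplacian.laplacian u x
      ≤ (u x - s) * (8 * ‖x - c‖ ^ 2 + 2 * Module.finrank ℝ E * ballBump R c x) := by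
  have h := Finset.sum_le_sum fun i (_ : i ∈ Finset.univ) =>
    iteratedFDeriv_le_of_isLocalMax_mul_ballBump hu
      ((stdOrthonormalBasis ℝ E).norm_eq_one i) hq hmax
  rw [← Finset.mul_sum, ← Finset.mul_sum, Finset.sum_add_distrib, ← Finset.mul_sum,
    OrthonormalBasis.sum_sq_inner_left] at h
  rw [InnerProductSpace.laplacian_eq_iteratedFDeriv_stdOrthonormalBasis]
  simp only [Finset.sum_const, Finset.card_univ, Fintype.card_fin, nsmul_eq_mul] at h
  linarith

/-- Minimum principle for `u - m (R² - |x - c|²)²`. -/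
theorem le_laplacian_of_isLocalMin_sub_ballBump_sq {u : E → ℝ} (hu : ContDiff ℝ 2 u)
    {R m : ℝ} {c x : E} (hmin : IsLocalMin (fun y => u y - m * ballBump R c y ^ 2) x) :
    m * (8 * ‖x - c‖ ^ 2 - 4 * Module.finrank ℝ E * ballBump R c x)
      ≤ Laplacian.laplacian u x := by
  have h := Finset.sum_le_sum fun i (_ : i ∈ Finset.univ) =>
    le_iteratedFDeriv_of_isLocalMin_sub_ballBump_sq hu
      ((stdOrthonormalBasis ℝ E).norm_eq_one i) hmin
  rw [← Finset.mul_sum, Finset.sum_sub_distrib, ← Finset.mul_sum,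
    OrthonormalBasis.sum_sq_inner_left] at h
  rw [InnerProductSpace.laplacian_eq_iteratedFDeriv_stdOrthonormalBasis]
  simp only [Finset.sum_const, Finset.card_univ, Fintype.card_fin, nsmul_eq_mul] at h
  linarith

/-! ### Interior bounds at scale `R` and the Liouville theorem -/

/-- Interior upper bound of Keller–Osserman type on the ball of radius `R`. -/
theorem sub_sq_mul_sq_le_of_laplacian_eq {a b s R : ℝ} (hb : 0 < b) (hs : 0 < s)
    (hsab : b * s ^ 2 = a) (hR : 0 < R) {u : E → ℝ} (hu : ContDiff ℝ 2 u)
    (heq : ∀ x, Laplacian.laplacian u x = b * u x ^ 3 - a * u x) {c : E} (hc : s ≤ u c) :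
    b * (u c - s) ^ 2 * R ^ 2 ≤ 8 + 2 * Module.finrank ℝ E := by
  rcases hc.eq_or_lt with hc | hc
  · rw [← hc, sub_self, zero_pow two_ne_zero, mul_zero, zero_mul]
    positivity
  have hcont : Continuous fun y => (u y - s) * ballBump R c y :=
    (hu.continuous.sub continuous_const).mul (continuous_ballBump R c)
  obtain ⟨y, hy, hymax⟩ := (isCompact_closedBall c R).exists_isMaxOn
    ⟨c, Metric.mem_closedBall_self hR.le⟩ hcont.continuousOn
  have hcy : (u c - s) * R ^ 2 ≤ (u y - s) * ballBump R c y := by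
    simpa [ballBump_self] using hymax (Metric.mem_closedBall_self hR.le)
  have hc0 : 0 < (u c - s) * R ^ 2 := mul_pos (sub_pos.2 hc) (by positivity)
  have hprod := hc0.trans_le hcy
  -- The product vanishes on the sphere but is positive at `c`, so the maximum is interior.
  have hq : 0 < ballBump R c y :=
    (ballBump_nonneg hy).lt_of_ne fun h => by rw [← h, mul_zero] at hprod; exact hprod.false
  have hv : 0 < u y - s := pos_of_mul_pos_left hprod hq.le
  have hloc := hymax.isLocalMax (Filter.mem_of_superset
    (Metric.isOpen_ball.mem_nhds (mem_ball_of_ballBump_pos hR hq)) Metric.ball_subset_closedBall)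
  have hmain := laplacian_le_of_isLocalMax_mul_ballBump hu hq hloc
  -- Expand around the root `s` of `b u³ - a u`: with `v = u - s > 0` every term is nonnegative.
  have hlap : b * (u y - s) ^ 3 ≤ Laplacian.laplacian u y := by
    rw [heq, ← hsab]
    have : b * u y ^ 3 - b * s ^ 2 * u y - b * (u y - s) ^ 3
      = b * (3 * s * (u y - s) ^ 2 + 2 * s ^ 2 * (u y - s)) := by ring
    have : 0 ≤ b * (3 * s * (u y - s) ^ 2 + 2 * s ^ 2 * (u y - s)) := by positivity
    linarith
  have hrq : ‖y - c‖ ^ 2 = R ^ 2 - ballBump R c y := by simp [ballBump]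
  have hqR := ballBump_le R c y
  have hn : (0 : ℝ) ≤ Module.finrank ℝ E := Nat.cast_nonneg _
  rw [hrq] at hmain
  generalize (Module.finrank ℝ E : ℝ) = n at *
  generalize Laplacian.laplacian u y = w at *
  have h1 : ballBump R c y ^ 2 * (b * (u y - s) ^ 3)
      ≤ (u y - s) * ((8 + 2 * n) * R ^ 2) :=
    (mul_le_mul_of_nonneg_left hlap (sq_nonneg _)).trans
      (hmain.trans (mul_le_mul_of_nonneg_left (by nlinarith) hv.le))
  have h2 : b * ((u y - s) * ballBump R c y) ^ 2 ≤ (8 + 2 * n) * R ^ 2 := by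
    refine le_of_mul_le_mul_left ?_ hv
    linarith
  have h3 : b * ((u c - s) * R ^ 2) ^ 2 ≤ (8 + 2 * n) * R ^ 2 :=
    (mul_le_mul_of_nonneg_left (pow_le_pow_left₀ hc0.le hcy 2) hb.le).trans h2
  refine le_of_mul_le_mul_right ?_ (by positivity : 0 < R ^ 2)
  linarith

/-- Interior lower bound on the ball of radius `R`. -/
theorem le_mul_sq_of_laplacian_eq {a b R : ℝ} (hb : 0 < b) (hR : 0 < R)
    {u : E → ℝ} (hu : ContDiff ℝ 2 u) (hpos : ∀ x, 0 < u x)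
    (heq : ∀ x, Laplacian.laplacian u x = b * u x ^ 3 - a * u x) (c : E) :
    a - (8 + 4 * Module.finrank ℝ E) ^ 2 / (32 * R ^ 2) ≤ b * u c ^ 2 := by
  -- Maximising `q² / u`, which is continuous up to the sphere, yields the largest `m` with `m q² ≤
  -- u` on the ball.
  have hcont : Continuous fun y => ballBump R c y ^ 2 / u y :=
    ((continuous_ballBump R c).pow 2).div₀ hu.continuous fun y => (hpos y).ne'
  obtain ⟨y, hy, hymax⟩ := (isCompact_closedBall c R).exists_isMaxOn
    ⟨c, Metric.mem_closedBall_self hR.le⟩ hcont.continuousOn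
  have hcy : (R ^ 2) ^ 2 / u c ≤ ballBump R c y ^ 2 / u y := by
    simpa [ballBump_self] using hymax (Metric.mem_closedBall_self hR.le)
  have hc0 : 0 < (R ^ 2) ^ 2 / u c := div_pos (by positivity) (hpos c)
  have hq : 0 < ballBump R c y :=
    (ballBump_nonneg hy).lt_of_ne fun h => by
      rw [← h] at hcy
      simp only [ne_eq, OfNat.ofNat_ne_zero, not_false_eq_true, zero_pow, zero_div] at hcy
      linarith
  obtain ⟨m, hm⟩ : ∃ m, m = u y / ballBump R c y ^ 2 := ⟨_, rfl⟩
  have hm0 : 0 < m := hm ▸ div_pos (hpos y) (by positivity)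
  have huy : u y = m * ballBump R c y ^ 2 := by rw [hm]; field_simp
  have hball : ∀ z ∈ Metric.closedBall c R, m * ballBump R c z ^ 2 ≤ u z := by
    intro z hz
    have h : ballBump R c z ^ 2 / u z ≤ ballBump R c y ^ 2 / u y := hymax hz
    rw [div_le_div_iff₀ (hpos z) (hpos y), huy] at h
    refine le_of_mul_le_mul_left ?_ (by positivity : 0 < ballBump R c y ^ 2)
    linarith
  have hloc : IsLocalMin (fun z => u z - m * ballBump R c z ^ 2) y := by
    filter_upwards [Metric.isOpen_ball.mem_nhds (mem_ball_of_ballBump_pos hR hq)] with z hz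
    have := hball z (Metric.ball_subset_closedBall hz)
    rw [huy]
    linarith
  have hmain := le_laplacian_of_isLocalMin_sub_ballBump_sq hu hloc
  have hrq : ‖y - c‖ ^ 2 = R ^ 2 - ballBump R c y := by simp [ballBump]
  have hqR := ballBump_le R c y
  have hyc : u y ≤ u c := by
    have h := hball c (Metric.mem_closedBall_self hR.le)
    rw [ballBump_self] at h
    rw [huy]
    exact (mul_le_mul_of_nonneg_left (pow_le_pow_left₀ hq.le hqR 2) hm0.le).trans h
  have hy2 : b * u y ^ 2 ≤ b * u c ^ 2 :=
    mul_le_mul_of_nonneg_left (pow_le_pow_left₀ (hpos y).le hyc 2) hb.le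
  refine le_trans ?_ hy2
  rw [heq, hrq] at hmain
  have hfac : b * u y ^ 3 - a * u y = m * ((b * u y ^ 2 - a) * ballBump R c y ^ 2) := by
    calc b * u y ^ 3 - a * u y = u y * (b * u y ^ 2 - a) := by ring
      _ = m * ballBump R c y ^ 2 * (b * u y ^ 2 - a) := by rw [← huy]
      _ = _ := by ring
  rw [hfac] at hmain
  have h1 := le_of_mul_le_mul_left hmain hm0
  generalize (Module.finrank ℝ E : ℝ) = n at *
  generalize ballBump R c y = q at *
  -- The constant is the one for which this quadratic in `q` has zero discriminant.
  have hdisc : 0 ≤ 8 * R ^ 2 - (8 + 4 * n) * q + (8 + 4 * n) ^ 2 / (32 * R ^ 2) * q ^ 2 := by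
    have : 8 * R ^ 2 - (8 + 4 * n) * q + (8 + 4 * n) ^ 2 / (32 * R ^ 2) * q ^ 2
        = (16 * R ^ 2 - (8 + 4 * n) * q) ^ 2 / (32 * R ^ 2) := by
      field_simp
      ring
    rw [this]
    positivity
  refine le_of_mul_le_mul_right ?_ (by positivity : 0 < q ^ 2)
  linarith

/-- The only positive entire solution of `Δu + a u - b u³ = 0` is the constant `√(a / b)`. -/
theorem eq_sqrt_of_laplacian_eq {a b : ℝ} (ha : 0 < a) (hb : 0 < b) {u : E → ℝ}
    (hu : ContDiff ℝ 2 u) (hpos : ∀ x, 0 < u x)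
    (heq : ∀ x, Laplacian.laplacian u x = b * u x ^ 3 - a * u x) (x : E) :
    u x = √(a / b) := by
  have hs : 0 < √(a / b) := Real.sqrt_pos.2 (div_pos ha hb)
  have hsab : b * √(a / b) ^ 2 = a := by
    rw [Real.sq_sqrt (div_pos ha hb).le]
    field_simp
  have hinv (K : ℝ) : Filter.Tendsto (fun R : ℝ => K / R ^ 2) Filter.atTop (nhds 0) :=
    tendsto_const_nhds.div_atTop (Filter.tendsto_pow_atTop two_ne_zero)
  apply le_antisymm
  · by_contra! hlt
    have hle : b * (u x - √(a / b)) ^ 2 ≤ 0 := by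
      refine ge_of_tendsto (hinv (8 + 2 * Module.finrank ℝ E)) ?_
      filter_upwards [Filter.eventually_gt_atTop 0] with R hR
      rw [le_div_iff₀ (by positivity)]
      exact sub_sq_mul_sq_le_of_laplacian_eq hb hs hsab hR hu heq hlt.le
    have : 0 < b * (u x - √(a / b)) ^ 2 := mul_pos hb (pow_pos (sub_pos.2 hlt) 2)
    linarith
  · have hle : a ≤ b * u x ^ 2 := by
      have h := (hinv ((8 + 4 * Module.finrank ℝ E) ^ 2 / 32)).const_sub a
      rw [sub_zero] at h
      refine le_of_tendsto h ?_
      filter_upwards [Filter.eventually_gt_atTop 0] with R hR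
      rw [div_div]
      exact le_mul_sq_of_laplacian_eq hb hR hu hpos heq x
    rw [Real.sqrt_le_iff]
    refine ⟨(hpos x).le, ?_⟩
    rw [div_le_iff₀ hb]
    linarith

end Laplacian

theorem corollary4p4 (n : ℕ) (a b : ℝ) (ha : 0 < a) (hb : 0 < b)
    (f : EuclideanSpace ℝ (Fin n) → ℝ → ℝ)
    (hf : IsNewellWhiteheadSolution a b f)
    (hpos : ∀ x, ∀ t : ℝ, 0 ≤ t → 0 < f x t)
    (hstanding : IsStanding f) :
    ∃ c : ℝ, ∀ x, ∀ t : ℝ, 0 ≤ t → f x t = c := by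
  have hslice : ∀ x, ∀ t : ℝ, 0 < t → f x t = √(a / b) := by
    intro x t ht
    refine eq_sqrt_of_laplacian_eq ha hb (hf.contDiff_space t ht) (fun y => hpos y t ht.le) ?_ x
    intro y
    have h := hf.equation y t ht
    rw [hstanding y t ht] at h
    linarith
  refine ⟨√(a / b), fun x t ht => ?_⟩
  rcases ht.eq_or_lt with rfl | ht
  -- The equation says nothing at `t = 0`; the value there is the limit as `t → 0⁺`.
  · have hcont : ContinuousWithinAt (fun s : ℝ => f x s) (Set.Ioi 0) 0 := by
      have h := hf.continuousOn (x, 0) ⟨trivial, Set.mem_Ici.2 le_rfl⟩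
      have hp : ContinuousWithinAt (fun s : ℝ => (x, s)) (Set.Ioi 0) 0 :=
        Continuous.continuousWithinAt (by fun_prop)
      exact ContinuousWithinAt.comp (f := fun s : ℝ => (x, s)) h hp
        fun s hs => ⟨trivial, Set.mem_Ici.2 (le_of_lt hs)⟩
    refine tendsto_nhds_unique hcont (tendsto_const_nhds.congr' ?_)
    filter_upwards [self_mem_nhdsWithin] with s hs using (hslice x s hs).symm
  · exact hslice x t ht
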